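/- Let $\mathcal A$ be a complex unital Banach algebra. An element $u\in\mathcal A$ is quasinilpotent if its spectral radius is $0$. An element $a\in\mathcal A$ is generalized Drazin invertible, written $a\in\mathcal A^d$, if there is $a^d\in\mathcal A$ (necessarily unique) such that $a^d a a^d=a^d$, $aa^d=a^da$ and $a-a^2a^d$ is quasinilpotent; put $a^\pi=1-aa^d$. Let $a,b\in\mathcal A^d$ satisfy $a^\pi ba=a^\pi aba^\pi$, and suppose that at least one of the elements $$a^\pi ba^\pi,\quad a^\pi b,\quad ba^\pi,\quad aa^dbaa^d,\quad aa^db,\quad baa^d$$ is generalized Drazin invertible. Put $e=(a+b)aa^d$. Then $$a+b\in\mathcal A^d\iff aa^d(a+b)\in\mathcal A^d\iff e\in\mathcal A^d\iff aa^d(a+b)aa^d\in\mathcal A^d .$$ In this case, all the series below converge (unconditionally, in norm) and $$\begin{aligned} (a+b)^d={}&e^d+\sum_{n=0}^\infty a^\pi(-a)^n(b^d)^{n+1}-\sum_{n=0}^\infty e^dba^\pi(-a)^n(b^d)^{n+1}\\ &+\sum_{n=0}^\infty e^\pi e^n aa^db\Bigl(\sum_{k=0}^\infty a^\pi(-a)^k(b^d)^{k+1}\Bigr)^{n+2}\\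 &+\sum_{n=0}^\infty\Bigl[(e^d)^{n+2}ba^\pi(a+b)^n-\sum_{k=0}^\infty(e^d)^{n+2}ba^\pi(a+b)^{n+1}a^\pi(-a)^k(b^d)^{k+1}\Bigr]. \end{aligned}$$ -/

import Mathlib

/-- An element of a complex Banach algebra is quasinilpotent if its spectral radius is zero. -/
def IsQuasinilpotent {A : Type*} [NormedRing A] [NormedAlgebra ℂ A] (a : A) : Prop :=
  spectralRadius ℂ a = 0

/-- `x` is a generalized (Koliha) Drazin inverse of `a`:
`x a x = x`, `a x = x a`, and `a - a² x` is quasinilpotent. -/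
structure IsGDrazinInverse {A : Type*} [NormedRing A] [NormedAlgebra ℂ A] (a x : A) : Prop where
  mul_mul_self : x * a * x = x
  comm : a * x = x * a
  quasinilpotent : IsQuasinilpotent (a - a ^ 2 * x)

/-- `a` is generalized Drazin invertible, that is, `a` belongs to `A^d`. -/
def GDInvertible {A : Type*} [NormedRing A] [NormedAlgebra ℂ A] (a : A) : Prop :=
  ∃ x : A, IsGDrazinInverse a x

open Classical in
/-- The generalized Drazin inverse `a^d` of `a` (with value `0` if `a` has none); it is the
unique one, see `IsGDrazinInverse.eq_gdInv`. -/
noncomputable def gdInv {A : Type*} [NormedRing A] [NormedAlgebra ℂ A] (a : A) : A :=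
  if h : ∃ x : A, IsGDrazinInverse a x then h.choose else 0

postfix:max "ᵈ" => gdInv

/-- The spectral idempotent `a^π = 1 - a a^d`. -/
noncomputable def spectralIdem {A : Type*} [NormedRing A] [NormedAlgebra ℂ A] (a : A) : A :=
  1 - a * aᵈ

postfix:max "ᵖⁱ" => spectralIdem

theorem GDInvertible.isGDrazinInverse {A : Type*} [NormedRing A] [NormedAlgebra ℂ A] {a : A}
    (h : GDInvertible a) : IsGDrazinInverse a aᵈ := by
  have h' : ∃ x : A, IsGDrazinInverse a x := h
  unfold gdInv
  rw [dif_pos h']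
  exact h'.choose_spec

/-- For a quasinilpotent `u` and any `x`, `‖u ^ n‖ * ‖x‖ ^ n` tends to zero. -/
theorem IsQuasinilpotent.tendsto_mul_pow {A : Type*} [NormedRing A] [NormedAlgebra ℂ A]
    [CompleteSpace A] {u : A} (hu : IsQuasinilpotent u) (x : A) :
    Filter.Tendsto (fun n : ℕ => ‖u ^ n‖ * ‖x‖ ^ n) Filter.atTop (nhds 0) := by
  have hG := spectrum.pow_nnnorm_pow_one_div_tendsto_nhds_spectralRadius u
  rw [show spectralRadius ℂ u = 0 from hu] at hG
  have hc : (0 : ENNReal) < ((2 * (‖x‖₊ + 1))⁻¹ : NNReal) := by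
    rw [ENNReal.coe_pos]; positivity
  have hev := (hG.eventually_lt_const hc).and (Filter.eventually_gt_atTop 0)
  refine squeeze_zero' (Filter.Eventually.of_forall fun n => by positivity) ?_
    (tendsto_pow_atTop_nhds_zero_of_lt_one (r := (1 / 2 : ℝ)) (by norm_num) (by norm_num))
  filter_upwards [hev] with n hn
  obtain ⟨h1, h2⟩ := hn
  have hn0 : (n : ℝ) ≠ 0 := by exact_mod_cast h2.ne'
  have h3 : (‖u ^ n‖₊ : ENNReal) ≤ (((2 * (‖x‖₊ + 1))⁻¹ ^ n : NNReal) : ENNReal) := by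
    have h4 := ENNReal.rpow_le_rpow h1.le (Nat.cast_nonneg (α := ℝ) n)
    rw [← ENNReal.rpow_mul, one_div, inv_mul_cancel₀ hn0, ENNReal.rpow_one,
      ENNReal.rpow_natCast] at h4
    exact_mod_cast h4
  have h5 : ‖u ^ n‖ ≤ (2 * (‖x‖ + 1))⁻¹ ^ n := by exact_mod_cast h3
  calc ‖u ^ n‖ * ‖x‖ ^ n ≤ (2 * (‖x‖ + 1))⁻¹ ^ n * ‖x‖ ^ n := by gcongr
    _ = ((2 * (‖x‖ + 1))⁻¹ * ‖x‖) ^ n := (mul_pow _ _ _).symm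
    _ ≤ (1 / 2) ^ n := by
      have h6 : (2 * (‖x‖ + 1))⁻¹ * ‖x‖ ≤ 1 / 2 := by
        have := norm_nonneg x
        rw [inv_mul_le_iff₀ (by positivity)]
        linarith
      gcongr

theorem IsGDrazinInverse.mul_eq {A : Type*} [NormedRing A] [NormedAlgebra ℂ A] [CompleteSpace A]
    {a x y : A} (hx : IsGDrazinInverse a x) (hy : IsGDrazinInverse a y) :
    a * x = a * y * (a * x) ∧ a * x = a * x * (a * y) := by
  have hcx : Commute a x := hx.comm
  have hcy : Commute a y := hy.comm
  have hq : IsIdempotentElem (1 - a * y) := by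
    apply IsIdempotentElem.one_sub
    change a * y * (a * y) = a * y
    rw [mul_assoc, ← mul_assoc y, hy.mul_mul_self]
  have hp : IsIdempotentElem (a * x) := by
    change a * x * (a * x) = a * x
    rw [mul_assoc, ← mul_assoc x, hx.mul_mul_self]
  have hcq : Commute a (1 - a * y) :=
    (Commute.one_right a).sub_right ((Commute.refl a).mul_right hcy)
  have hu : a - a ^ 2 * y = a * (1 - a * y) := by noncomm_ring
  have hlim := (hy.quasinilpotent).tendsto_mul_pow x
  rw [hu] at hlim
  have hpow : ∀ n : ℕ, (a * (1 - a * y)) ^ (n + 1) = a ^ (n + 1) * (1 - a * y) := fun n => by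
    rw [hcq.mul_pow, hq.pow_succ_eq]
  have hpn : ∀ n : ℕ, a ^ (n + 1) * x ^ (n + 1) = a * x := fun n => by
    rw [← hcx.mul_pow, hp.pow_succ_eq]
  have key1 : (1 - a * y) * (a * x) = 0 := by
    rw [← norm_le_zero_iff]
    refine ge_of_tendsto (hlim.comp (Filter.tendsto_add_atTop_nat 1)) ?_
    refine Filter.Eventually.of_forall fun n => ?_
    have : (1 - a * y) * (a * x) = (a * (1 - a * y)) ^ (n + 1) * x ^ (n + 1) := by
      rw [hpow, (hcq.pow_left (n + 1)).eq, mul_assoc, hpn]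
    rw [this]
    exact (norm_mul_le _ _).trans (mul_le_mul_of_nonneg_left
      (norm_pow_le' x n.succ_pos) (norm_nonneg _))
  have key2 : (a * x) * (1 - a * y) = 0 := by
    rw [← norm_le_zero_iff]
    refine ge_of_tendsto (hlim.comp (Filter.tendsto_add_atTop_nat 1)) ?_
    refine Filter.Eventually.of_forall fun n => ?_
    have : (a * x) * (1 - a * y) = x ^ (n + 1) * (a * (1 - a * y)) ^ (n + 1) := by
      rw [hpow, ← mul_assoc, ← (hcx.pow_pow (n + 1) (n + 1)).eq, hpn]
    rw [this]
    refine (norm_mul_le _ _).trans ?_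
    rw [mul_comm]
    exact mul_le_mul_of_nonneg_left (norm_pow_le' x n.succ_pos) (norm_nonneg _)
  constructor
  · rw [sub_mul, one_mul, sub_eq_zero] at key1
    exact key1
  · rw [mul_sub, mul_one, sub_eq_zero] at key2
    exact key2

/-- The generalized Drazin inverse is unique. -/
theorem IsGDrazinInverse.unique {A : Type*} [NormedRing A] [NormedAlgebra ℂ A] [CompleteSpace A]
    {a x y : A} (hx : IsGDrazinInverse a x) (hy : IsGDrazinInverse a y) : x = y := by
  have h : a * x = a * y := (hx.mul_eq hy).1.trans (hy.mul_eq hx).2.symm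
  calc x = x * (a * x) := by rw [← mul_assoc, hx.mul_mul_self]
    _ = x * a * y := by rw [h, mul_assoc]
    _ = y * a * y := by rw [← hx.comm, h, hy.comm]
    _ = y := hy.mul_mul_self

theorem IsGDrazinInverse.eq_gdInv {A : Type*} [NormedRing A] [NormedAlgebra ℂ A]
    [CompleteSpace A] {a x : A} (hx : IsGDrazinInverse a x) : aᵈ = x :=
  (GDInvertible.isGDrazinInverse ⟨x, hx⟩).unique hx

/-! With respect to the idempotent `p = a aᵈ`, the hypothesis on `aᵖⁱ b a` makes both `b` and
`a + b` block upper triangular. A block triangular element whose diagonal blocks have generalized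
Drazin inverses has one too, with the inverses of the blocks on its diagonal; commutation with the
element is a Sylvester equation for the corner entry, solved by two series that converge because
they involve powers of quasinilpotent elements. Conversely, the invertibility of the element and
of one diagonal block passes to the other one. For `a + b` the first diagonal block is `e`. The
second, `aᵖⁱ (a + b)`, is the sum of `aᵖⁱ b` and the quasinilpotent `a aᵖⁱ`, which commute, so its
generalized Drazin inverse is a Neumann series. -/

theorem one_sub_mul_eq_one_sub_mul_mul_one_sub {R : Type*} [Ring R] {p x : R}
    (h : x * p = p * x * p) : (1 - p) * x = (1 - p) * x * (1 - p) := by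
  rw [mul_sub, mul_one, mul_assoc, sub_mul 1 p (x * p), one_mul, ← mul_assoc, ← h, sub_self,
    sub_zero]

theorem triangular_mul_triangular {R : Type*} [Ring R] {p q d c s d' c' s' : R} (hpq : p * q = 0)
    (hqp : q * p = 0) (hd : d * p = d) (hc : c * q = c) (hs : s * q = s) (hd' : p * d' = d')
    (hc' : q * c' = c') (hs' : p * s' = s') :
    (d + c + s) * (d' + c' + s') = d * d' + c * c' + (d * s' + s * c') := by
  have hzero {r t : R} {y z : R} (hr : r * y = r) (ht : z * t = t) (h : y * z = 0) :
      r * t = 0 := by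
    rw [← hr, ← ht, mul_assoc, ← mul_assoc y, h, zero_mul, mul_zero]
  simp only [add_mul, mul_add, hzero hd hc' hpq, hzero hc hd' hqp, hzero hc hs' hqp,
    hzero hs hd' hqp, hzero hs hs' hqp, add_zero, zero_add]
  abel

section Quasinilpotent

variable {A : Type*} [NormedRing A] [NormedAlgebra ℂ A] {u v z p q : A}

theorem isQuasinilpotent_iff_isUnit :
    IsQuasinilpotent u ↔ ∀ c : ℂ, IsUnit (1 - c • u) := by
  constructor
  · intro hu c
    refine spectrum.isUnit_one_sub_smul_of_lt_inv_radius ?_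
    rw [show spectralRadius ℂ u = 0 from hu, ENNReal.inv_zero]
    exact ENNReal.coe_lt_top
  · intro hu
    have hspec : ∀ k ∈ spectrum ℂ u, k = 0 := fun k hk => by
      by_contra hk0
      refine spectrum.mem_iff.1 hk ?_
      have hfactor : algebraMap ℂ A k - u = algebraMap ℂ A k * (1 - k⁻¹ • u) := by
        rw [← Algebra.smul_def, smul_sub, smul_inv_smul₀ hk0, Algebra.algebraMap_eq_smul_one]
      rw [hfactor]
      exact ((IsUnit.mk0 k hk0).map (algebraMap ℂ A)).mul (hu k⁻¹)
    refine le_antisymm (iSup₂_le fun k hk => ?_) bot_le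
    simp [hspec k hk]

theorem isQuasinilpotent_of_summable (h : ∀ c : ℂ, Summable fun n : ℕ => (c • u) ^ n) :
    IsQuasinilpotent u :=
  isQuasinilpotent_iff_isUnit.2 fun c =>
    ⟨⟨1 - c • u, _, (h c).one_sub_mul_tsum_pow, (h c).tsum_pow_mul_one_sub⟩, rfl⟩

theorem isQuasinilpotent_op : IsQuasinilpotent (MulOpposite.op u) ↔ IsQuasinilpotent u := by
  simp only [isQuasinilpotent_iff_isUnit, ← MulOpposite.op_smul, ← MulOpposite.op_one,
    ← MulOpposite.op_sub, isUnit_op]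

namespace IsQuasinilpotent

theorem smul (hu : IsQuasinilpotent u) (c : ℂ) : IsQuasinilpotent (c • u) :=
  isQuasinilpotent_iff_isUnit.2 fun k => by
    rw [smul_smul]
    exact isQuasinilpotent_iff_isUnit.1 hu _

theorem neg (hu : IsQuasinilpotent u) : IsQuasinilpotent (-u) := by
  simpa using hu.smul (-1)

theorem mul_comm (h : IsQuasinilpotent (u * v)) : IsQuasinilpotent (v * u) := by
  refine isQuasinilpotent_iff_isUnit.2 fun c => ?_
  have hswap := spectrum.unit_mem_mul_comm (R := ℂ) (r := 1) (a := u) (b := c • v)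
  simp only [Units.val_one, spectrum.mem_iff, map_one, not_iff_not, mul_smul_comm,
    smul_mul_assoc] at hswap
  exact hswap.1 (isQuasinilpotent_iff_isUnit.1 h c)

theorem of_triangular (hp : IsIdempotentElem p) (hz : z * p = p * z * p)
    (hzp : IsQuasinilpotent (z * p)) (hqz : IsQuasinilpotent ((1 - p) * z)) :
    IsQuasinilpotent z := by
  refine isQuasinilpotent_iff_isUnit.2 fun c => ?_
  have hqzp : (1 - p) * z * p = 0 := by rw [sub_mul, sub_mul, one_mul, hz, sub_self]
  have hqp : (1 - p) * p = 0 := hp.one_sub_mul_self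
  have hnil : IsNilpotent (c • (p * z * (1 - p))) := by
    refine ⟨2, ?_⟩
    have : p * z * (1 - p) * (p * z * (1 - p)) = p * z * ((1 - p) * p) * (z * (1 - p)) := by
      noncomm_ring
    rw [smul_pow, pow_two (p * z * (1 - p)), this, hqp, mul_zero, zero_mul, smul_zero]
  -- `[1 - a, -s; 0, 1 - d] = [1, 0; 0, 1 - d] * [1, -s; 0, 1] * [1 - a, 0; 0, 1]`
  have hfactor : 1 - c • z =
      (1 - c • ((1 - p) * z)) * (1 - c • (p * z * (1 - p))) * (1 - c • (z * p)) := by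
    have hDS : (1 - p) * z * (p * z * (1 - p)) = 0 := by simp only [← mul_assoc, hqzp, zero_mul]
    have hDE : (1 - p) * z * (z * p) = 0 := by rw [hz, ← mul_assoc, ← mul_assoc, hqzp]; simp
    have hSE : p * z * (1 - p) * (z * p) = 0 := by rw [mul_assoc, ← mul_assoc _ z, hqzp, mul_zero]
    have hmul {r t : A} (h : r * t = 0) : (1 - r) * (1 - t) = 1 - (r + t) := by
      rw [mul_sub, mul_one, sub_mul, one_mul, h, sub_zero, sub_sub]
    rw [hmul (by rw [smul_mul_smul_comm, hDS, smul_zero]), ← smul_add,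
      hmul (by rw [smul_mul_smul_comm, add_mul, hDE, hSE, add_zero, smul_zero]), ← smul_add,
      sub_mul, one_mul, mul_sub, mul_one, ← hz, sub_add_sub_cancel, sub_add_cancel]
  rw [hfactor]
  exact ((isQuasinilpotent_iff_isUnit.1 hqz c).mul hnil.isUnit_one_sub).mul
    (isQuasinilpotent_iff_isUnit.1 hzp c)

variable [CompleteSpace A]

theorem summable_pow_mul_mul_pow (hu : IsQuasinilpotent u) (s y : A) :
    Summable fun n : ℕ => u ^ n * s * y ^ n := by
  have hlim := hu.tendsto_mul_pow ((2 : ℂ) • y)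
  refine Summable.of_norm_bounded_eventually_nat (summable_geometric_two.mul_left ‖s‖) ?_
  filter_upwards [hlim.eventually_le_const one_pos, Filter.eventually_gt_atTop 0] with n hn hpos
  have hdecay : ‖u ^ n‖ * ‖y‖ ^ n ≤ (1 / 2) ^ n := by
    rw [norm_smul, Complex.norm_ofNat, mul_pow] at hn
    rw [one_div, inv_pow, ← one_div, le_div_iff₀ (by positivity)]
    linarith
  calc ‖u ^ n * s * y ^ n‖ ≤ ‖u ^ n‖ * ‖s‖ * ‖y‖ ^ n :=
        (norm_mul₃_le).trans (by gcongr; exact norm_pow_le' y hpos)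
    _ = ‖s‖ * (‖u ^ n‖ * ‖y‖ ^ n) := by ring
    _ ≤ ‖s‖ * (1 / 2) ^ n := by gcongr

theorem summable_neg_pow_mul_pow_succ (hu : IsQuasinilpotent u) (y : A) :
    Summable fun n : ℕ => (-u) ^ n * y ^ (n + 1) := by
  simpa only [pow_succ', mul_assoc] using hu.neg.summable_pow_mul_mul_pow y y

theorem summable_pow (hu : IsQuasinilpotent u) : Summable fun n : ℕ => u ^ n := by
  simpa using hu.summable_pow_mul_mul_pow 1 1

theorem mul_of_commute (hu : IsQuasinilpotent u) (h : Commute u v) : IsQuasinilpotent (u * v) := by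
  refine isQuasinilpotent_of_summable fun c => ?_
  simpa only [mul_one, ← (h.smul_right c).mul_pow, mul_smul_comm] using
    hu.summable_pow_mul_mul_pow 1 (c • v)

theorem add_of_commute (hu : IsQuasinilpotent u) (hv : IsQuasinilpotent v) (h : Commute u v) :
    IsQuasinilpotent (u + v) := by
  refine isQuasinilpotent_iff_isUnit.2 fun c => ?_
  obtain ⟨r, hr⟩ := isQuasinilpotent_iff_isUnit.1 hu c
  have hvr : Commute v (↑r⁻¹ : A) := by
    refine Commute.units_inv_right ?_
    rw [hr]
    exact (Commute.one_right v).sub_right (h.symm.smul_right c)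
  have hfactor : 1 - c • (u + v) = r * (1 - c • (v * ↑r⁻¹)) := by
    rw [hvr.eq, mul_sub, mul_smul_comm, r.mul_inv_cancel_left, hr, smul_add, mul_one, sub_sub]
  rw [hfactor]
  exact r.isUnit.mul (isQuasinilpotent_iff_isUnit.1 (hv.mul_of_commute hvr) c)

theorem compress (hz : IsQuasinilpotent z) (h : q * z = q * z * q) : IsQuasinilpotent (q * z) := by
  refine isQuasinilpotent_of_summable fun c => (summable_nat_add_iff 1).1 ?_
  have hsemi : SemiconjBy q (c • z) (c • (q * z)) := by
    rw [SemiconjBy, mul_smul_comm, smul_mul_assoc, ← h]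
  have hpow (n : ℕ) : (c • (q * z)) ^ (n + 1) = q * (c • z) ^ (n + 1) := by
    rw [pow_succ, pow_succ, ← mul_assoc, (hsemi.pow_right n).eq, mul_assoc]
    simp only [mul_smul_comm]
  simp_rw [hpow]
  exact ((summable_nat_add_iff 1).2 (hz.smul c).summable_pow).mul_left q

end IsQuasinilpotent

end Quasinilpotent

section GDrazin

open MulOpposite

variable {A : Type*} [NormedRing A] [NormedAlgebra ℂ A] {a b c u x y s p q : A}

namespace IsGDrazinInverse

theorem isIdempotentElem (h : IsGDrazinInverse a x) : IsIdempotentElem (a * x) := by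
  rw [IsIdempotentElem, mul_assoc, ← mul_assoc x, h.mul_mul_self]

theorem mul_idem (h : IsGDrazinInverse a x) : x * (a * x) = x := by
  rw [← mul_assoc, h.mul_mul_self]

theorem idem_mul (h : IsGDrazinInverse a x) : a * x * x = x := by
  rw [h.comm, h.mul_mul_self]

theorem commute_idem (h : IsGDrazinInverse a x) : Commute a (a * x) :=
  (Commute.refl a).mul_right h.comm

theorem pow_mul_pow_mul_idem (h : IsGDrazinInverse a x) (n : ℕ) :
    x ^ n * a ^ n * (a * x) = a * x := by
  rw [← Commute.mul_pow h.comm.symm, ← h.comm, ← pow_succ, h.isIdempotentElem.pow_succ_eq]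

theorem sub_sq_mul_pow_mul_one_sub (h : IsGDrazinInverse a x) (n : ℕ) :
    (a - a ^ 2 * x) ^ n * (1 - a * x) = a ^ n * (1 - a * x) := by
  have hfactor : a - a ^ 2 * x = a * (1 - a * x) := by noncomm_ring
  rw [hfactor, ((Commute.one_right a).sub_right h.commute_idem).mul_pow, mul_assoc, ← pow_succ,
    h.isIdempotentElem.one_sub.pow_succ_eq]

theorem op_op : IsGDrazinInverse (op a) (op x) ↔ IsGDrazinInverse a x := by
  have hsq (h : a * x = x * a) : op a - op a ^ 2 * op x = op (a - a ^ 2 * x) := by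
    rw [← op_pow, ← op_mul, ← op_sub, (Commute.pow_left h 2).eq]
  constructor
  · intro h
    have hcomm : a * x = x * a := congrArg unop h.comm.symm
    refine ⟨?_, hcomm, ?_⟩
    · rw [mul_assoc]
      exact congrArg unop h.mul_mul_self
    · exact isQuasinilpotent_op.1 (hsq hcomm ▸ h.quasinilpotent)
  · intro h
    refine ⟨?_, congrArg op h.comm.symm, ?_⟩
    · rw [mul_assoc, ← op_mul, ← op_mul, h.mul_mul_self]
    · exact hsq h.comm ▸ isQuasinilpotent_op.2 h.quasinilpotent

theorem mul_eq_of_mul_eq (h : IsGDrazinInverse a x) (hp : p * a = a) : p * x = x := by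
  rw [← h.idem_mul, ← mul_assoc, ← mul_assoc, hp]

theorem mul_eq_of_mul_eq' (h : IsGDrazinInverse a x) (hp : a * p = a) : x * p = x := by
  rw [← h.mul_idem, h.comm, mul_assoc, mul_assoc, hp]

end IsGDrazinInverse

theorem gdInvertible_op : GDInvertible (op a) ↔ GDInvertible a :=
  ⟨fun ⟨x, hx⟩ => ⟨unop x, IsGDrazinInverse.op_op.1 hx⟩,
    fun ⟨x, hx⟩ => ⟨op x, IsGDrazinInverse.op_op.2 hx⟩⟩

theorem GDInvertible.isIdempotentElem_spectralIdem (h : GDInvertible a) :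
    IsIdempotentElem aᵖⁱ :=
  h.isGDrazinInverse.isIdempotentElem.one_sub

theorem GDInvertible.commute_spectralIdem (h : GDInvertible a) : Commute a aᵖⁱ :=
  (Commute.one_right a).sub_right h.isGDrazinInverse.commute_idem

/-- Cline's formula. -/
theorem GDInvertible.mul_comm (h : GDInvertible (a * b)) : GDInvertible (b * a) := by
  obtain ⟨y, hy⟩ := h
  have hleft : b * a * (b * y ^ 2 * a) = b * y * a := by
    calc b * a * (b * y ^ 2 * a) = b * (a * b * y * y) * a := by noncomm_ring
      _ = b * y * a := by rw [hy.idem_mul]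
  have hright : b * y ^ 2 * a * (b * a) = b * y * a := by
    calc b * y ^ 2 * a * (b * a) = b * (y * (y * (a * b))) * a := by noncomm_ring
      _ = b * y * a := by rw [← hy.comm, hy.mul_idem]
  refine ⟨b * y ^ 2 * a, ?_, hleft.trans hright.symm, ?_⟩
  · calc b * y ^ 2 * a * (b * a) * (b * y ^ 2 * a) = b * (y * (a * b) * y) * y * a := by
          rw [hright]; noncomm_ring
      _ = b * y ^ 2 * a := by rw [hy.mul_mul_self]; noncomm_ring
  · have hswap : b * a - (b * a) ^ 2 * (b * y ^ 2 * a) = b * ((1 - a * b * y) * a) := by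
      rw [pow_two (b * a), mul_assoc (b * a), hleft]
      noncomm_ring
    rw [hswap]
    refine IsQuasinilpotent.mul_comm ?_
    convert hy.quasinilpotent using 1
    rw [mul_assoc, sub_mul, one_mul, mul_assoc _ y, ← hy.comm]
    noncomm_ring

namespace IsGDrazinInverse

variable [CompleteSpace A]

theorem summable_one_sub_mul_pow (h : IsGDrazinInverse a x) (s y : A) :
    Summable fun n : ℕ => (1 - a * x) * a ^ n * s * y ^ n := by
  have hcomm (n : ℕ) : (1 - a * x) * a ^ n = (a - a ^ 2 * x) ^ n * (1 - a * x) := by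
    rw [h.sub_sq_mul_pow_mul_one_sub]
    exact ((Commute.one_left _).sub_left (h.commute_idem.symm.pow_right n)).eq
  simpa only [hcomm, mul_assoc] using
    h.quasinilpotent.summable_pow_mul_mul_pow ((1 - a * x) * s) y

theorem summable_pow_mul_one_sub (h : IsGDrazinInverse a x) (s y : A) :
    Summable fun n : ℕ => y ^ n * s * (a ^ n * (1 - a * x)) := by
  refine summable_op.1 ?_
  simpa only [op_mul, op_sub, op_one, op_pow, mul_assoc, h.comm] using
    (op_op.2 h).summable_one_sub_mul_pow (op s) (op y)

theorem idem_mul_mul_one_sub (hx : IsGDrazinInverse a x) (hy : IsGDrazinInverse c y)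
    (h : a * s = s * c) : a * x * s * (1 - c * y) = 0 := by
  -- the left-hand side is summable over `n`, which forces its constant value to vanish
  have hconst (n : ℕ) : x ^ n * (a * x * s) * (c ^ n * (1 - c * y)) = a * x * s * (1 - c * y) := by
    have hpow : a ^ n * s = s * c ^ n := ((show SemiconjBy s c a from h.symm).pow_right n).eq.symm
    calc x ^ n * (a * x * s) * (c ^ n * (1 - c * y))
        = x ^ n * (a * x) * (s * c ^ n) * (1 - c * y) := by simp only [mul_assoc]
      _ = x ^ n * (a * x * a ^ n) * s * (1 - c * y) := by rw [← hpow]; simp only [mul_assoc]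
      _ = x ^ n * a ^ n * (a * x) * s * (1 - c * y) := by
        rw [← (hx.commute_idem.pow_left n).eq]; simp only [mul_assoc]
      _ = a * x * s * (1 - c * y) := by rw [hx.pow_mul_pow_mul_idem]
  have hsum := hy.summable_pow_mul_one_sub (a * x * s) x
  simp only [hconst] at hsum
  exact (summable_const_iff _).1 hsum

theorem one_sub_mul_mul_idem (hx : IsGDrazinInverse a x) (hy : IsGDrazinInverse c y)
    (h : a * s = s * c) : (1 - a * x) * s * (c * y) = 0 := by
  have hop := (op_op.2 hy).idem_mul_mul_one_sub (op_op.2 hx) (s := op s) (congrArg op h).symm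
  rw [hx.comm, hy.comm, mul_assoc]
  exact congrArg unop hop

theorem mul_eq_mul_of_mul_eq_mul (hx : IsGDrazinInverse a x) (hy : IsGDrazinInverse c y)
    (h : a * s = s * c) : x * s = s * y := by
  have hl : a * x * s = a * x * s * (c * y) := by
    simpa only [mul_sub, mul_one, sub_eq_zero] using hx.idem_mul_mul_one_sub hy h
  have hr : s * (c * y) = a * x * s * (c * y) := by
    simpa only [sub_mul, one_mul, sub_eq_zero] using hx.one_sub_mul_mul_idem hy h
  calc x * s = x * (a * x * s) := by rw [← mul_assoc, hx.mul_idem]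
    _ = x * s * (c * y) := by rw [hl, ← mul_assoc, ← mul_assoc x, hx.mul_idem]
    _ = x * (a * s) * y := by rw [h]; simp only [mul_assoc]
    _ = a * x * s * (c * y) * y := by rw [← hl, hx.comm]; simp only [mul_assoc]
    _ = s * y := by rw [← hr, mul_assoc, hy.idem_mul]

theorem commute_of_commute (h : IsGDrazinInverse a x) (hs : Commute a s) : Commute x s :=
  h.mul_eq_mul_of_mul_eq_mul h hs

theorem add_of_commute (h : IsGDrazinInverse a x) (hu : IsQuasinilpotent u) (hc : Commute a u) :
    IsGDrazinInverse (a + u) (∑' n : ℕ, (-u) ^ n * x ^ (n + 1)) := by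
  have hxu : Commute x u := h.commute_of_commute hc
  have hux : IsQuasinilpotent (-(u * x)) := (hu.mul_of_commute hxu.symm).neg
  obtain ⟨v, hv⟩ : ∃ v, v = ∑' n : ℕ, (-(u * x)) ^ n := ⟨_, rfl⟩
  have hmul_v : (1 + u * x) * v = 1 := by
    simpa only [sub_neg_eq_add, ← hv] using hux.summable_pow.one_sub_mul_tsum_pow
  have hcomm_v {t : A} (ht : Commute t (u * x)) : Commute t v :=
    hv ▸ Commute.tsum_right t fun n => ht.neg_right.pow_right n
  have hsum : ∑' n : ℕ, (-u) ^ n * x ^ (n + 1) = x * v := by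
    have hterm (n : ℕ) : (-u) ^ n * x ^ (n + 1) = x * (-(u * x)) ^ n := by
      rw [← neg_mul, hxu.symm.neg_left.mul_pow, pow_succ', ← mul_assoc, ← mul_assoc,
        (hxu.neg_right.pow_right n).eq]
    simp only [hterm, hux.summable_pow.tsum_mul_left, hv]
  have hleft : (a + u) * (x * v) = a * x := by
    have hax : (a + u) * x = a * x * (1 + u * x) := by
      rw [add_mul, mul_add, mul_one, ← mul_assoc, (hc.symm.mul_right hxu.symm).symm.eq, mul_assoc u,
        h.idem_mul]
    rw [← mul_assoc, hax, mul_assoc, hmul_v, mul_one]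
  have hcomm : Commute (a + u) (x * v) := by
    have hau : Commute (a + u) u := hc.add_left (Commute.refl u)
    have hax : Commute (a + u) x := (show Commute a x from h.comm).add_left hxu.symm
    exact hax.mul_right (hcomm_v (hau.mul_right hax))
  rw [hsum]
  refine ⟨?_, hcomm, ?_⟩
  · rw [← hcomm.eq, hleft, ← mul_assoc, h.idem_mul]
  · have hdecomp : a + u - (a + u) ^ 2 * (x * v) = (a - a ^ 2 * x) + u * (1 - a * x) := by
      rw [pow_two, mul_assoc, hleft]
      noncomm_ring
    have hidem : Commute a (1 - a * x) := (Commute.one_right a).sub_right h.commute_idem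
    have hu_idem : Commute u (1 - a * x) :=
      (Commute.one_right u).sub_right (hc.symm.mul_right hxu.symm)
    have hua : Commute u (a - a ^ 2 * x) :=
      hc.symm.sub_right ((hc.symm.pow_right 2).mul_right hxu.symm)
    rw [hdecomp]
    refine h.quasinilpotent.add_of_commute (hu.mul_of_commute hu_idem) (hua.symm.mul_right ?_)
    exact hidem.sub_left
      ((hidem.pow_left 2).mul_left ((Commute.one_right x).sub_right
        ((show Commute x a from h.comm.symm).mul_right (Commute.refl x))))

theorem compress (h : IsGDrazinInverse x y) (hx : q * x = q * x * q) (hy : q * y = q * y * q) :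
    IsGDrazinInverse (q * x) (q * y) := by
  have hmul {s t : A} (hs : q * s = q * s * q) : q * s * (q * t) = q * (s * t) := by
    rw [← mul_assoc, ← hs, mul_assoc]
  have hclosed {s t : A} (hs : q * s = q * s * q) (ht : q * t = q * t * q) :
      q * (s * t) = q * (s * t) * q := by
    rw [← hmul hs, mul_assoc (q * s), ← ht]
  refine ⟨?_, ?_, ?_⟩
  · rw [hmul hy, hmul (hclosed hy hx), h.mul_mul_self]
  · rw [hmul hx, hmul hy, h.comm]
  · have hz : q * x - (q * x) ^ 2 * (q * y) = q * (x - x ^ 2 * y) := by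
      rw [pow_two, pow_two, hmul hx, hmul (hclosed hx hx), mul_sub]
    rw [hz]
    refine h.quasinilpotent.compress ?_
    rw [mul_sub, sub_mul, ← hx, pow_two, ← hclosed (hclosed hx hx) hy]

end IsGDrazinInverse

namespace GDInvertible

variable [CompleteSpace A]

theorem one_sub_mul (hp : IsIdempotentElem p) (hx : x * p = p * x * p) (h : GDInvertible x)
    (h' : GDInvertible (x * p)) : GDInvertible ((1 - p) * x) := by
  obtain ⟨y, hy⟩ := h
  obtain ⟨c, hc⟩ := h'
  have hyp : y * p = p * c := hy.mul_eq_mul_of_mul_eq_mul hc (by rw [← mul_assoc, ← hx])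
  refine ⟨_, hy.compress (one_sub_mul_eq_one_sub_mul_mul_one_sub hx)
    (one_sub_mul_eq_one_sub_mul_mul_one_sub ?_)⟩
  rw [mul_assoc, hyp, ← mul_assoc, hp.eq]

theorem mul_right (hp : IsIdempotentElem p) (hx : x * p = p * x * p) (h : GDInvertible x)
    (h' : GDInvertible ((1 - p) * x)) : GDInvertible (x * p) := by
  have hpop : IsIdempotentElem (op (1 - p)) := congrArg op hp.one_sub.eq
  have hxop : op x * op (1 - p) = op (1 - p) * op x * op (1 - p) := by
    rw [mul_assoc]
    exact congrArg op (one_sub_mul_eq_one_sub_mul_mul_one_sub hx)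
  have hcorner := one_sub_mul hpop hxop (gdInvertible_op.2 h) (gdInvertible_op.2 h')
  rwa [← op_one, ← op_sub, sub_sub_cancel, ← op_mul, gdInvertible_op] at hcorner

theorem one_sub_mul_of_corner (hp : IsIdempotentElem p) (hb : GDInvertible b)
    (hbp : b * p = p * b * p)
    (h : GDInvertible ((1 - p) * b * (1 - p)) ∨ GDInvertible ((1 - p) * b) ∨
      GDInvertible (b * (1 - p)) ∨ GDInvertible (p * b * p) ∨ GDInvertible (p * b) ∨
      GDInvertible (b * p)) :
    GDInvertible ((1 - p) * b) := by
  rcases h with h | h | h | h | h | h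
  · rwa [one_sub_mul_eq_one_sub_mul_mul_one_sub hbp]
  · exact h
  · exact h.mul_comm
  · exact hb.one_sub_mul hp hbp (hbp ▸ h)
  · exact hb.one_sub_mul hp hbp h.mul_comm
  · exact hb.one_sub_mul hp hbp h

end GDInvertible

end GDrazin

section Triangular

variable {A : Type*} [NormedRing A] [NormedAlgebra ℂ A] {a c e p s w x z S : A}

/-- The off-diagonal entry of the generalized Drazin inverse of the block triangular matrix
`[a, s; 0, c]`, whose diagonal entries are `aᵈ` and `cᵈ`. -/
noncomputable def triangularCorner (a s c : A) : A :=
  (∑' n : ℕ, aᵖⁱ * a ^ n * s * cᵈ ^ (n + 2)) + (∑' n : ℕ, aᵈ ^ (n + 2) * s * (c ^ n * cᵖⁱ)) -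
    aᵈ * s * cᵈ

theorem isQuasinilpotent_sub_sq_mul_of_triangular (hp : IsIdempotentElem p)
    (hx : x * p = p * x * p) (hz : z * p = p * z * p)
    (h : IsQuasinilpotent (x * p - (x * p) ^ 2 * (z * p)))
    (h' : IsQuasinilpotent ((1 - p) * x - ((1 - p) * x) ^ 2 * ((1 - p) * z))) :
    IsQuasinilpotent (x - x ^ 2 * z) := by
  have hleft : (x - x ^ 2 * z) * p = x * p - (x * p) ^ 2 * (z * p) := by
    have hsq : (x * p) ^ 2 * z * p = x ^ 2 * z * p := by
      rw [pow_two, ← mul_assoc, mul_assoc x p x, mul_assoc x, ← hx, mul_assoc, mul_assoc x,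
        mul_assoc x p, ← mul_assoc p, ← hz, ← mul_assoc, ← mul_assoc, pow_two]
    rw [sub_mul, ← mul_assoc, hsq]
  have hright : (1 - p) * (x - x ^ 2 * z) =
      (1 - p) * x - ((1 - p) * x) ^ 2 * ((1 - p) * z) := by
    have hqx := one_sub_mul_eq_one_sub_mul_mul_one_sub hx
    have hsq : ((1 - p) * x) ^ 2 * (1 - p) = (1 - p) * x ^ 2 := by
      rw [pow_two, mul_assoc ((1 - p) * x), ← hqx, ← mul_assoc, ← hqx, mul_assoc, pow_two]
    rw [mul_sub, ← mul_assoc, ← hsq, mul_assoc]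
  refine .of_triangular hp ?_ (hleft ▸ h) (hright ▸ h')
  rw [mul_assoc p, hleft, mul_sub, pow_two]
  simp only [← mul_assoc, ← hx]

theorem IsGDrazinInverse.of_triangular (hp : IsIdempotentElem p) (hx : x * p = p * x * p)
    (he : IsGDrazinInverse (x * p) e) (hw : IsGDrazinInverse ((1 - p) * x) w) (hpS : p * S = S)
    (hSp : S * (1 - p) = S)
    (hsyl : x * p * S + p * x * (1 - p) * w = e * (p * x * (1 - p)) + S * ((1 - p) * x))
    (hS : x * p * e * S + S * ((1 - p) * x * w) + e * (p * x * (1 - p)) * w = S) :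
    IsGDrazinInverse x (e + w + S) := by
  have hqq := hp.one_sub.eq
  have hqp := hp.one_sub_mul_self
  have hpq := hp.mul_one_sub_self
  have hxp : x * p * p = x * p := by rw [mul_assoc, hp.eq]
  have hqx : (1 - p) * ((1 - p) * x) = (1 - p) * x := by rw [← mul_assoc, hqq]
  have hpxp : p * (x * p) = x * p := by rw [← mul_assoc, ← hx]
  have hqxq : (1 - p) * x * (1 - p) = (1 - p) * x :=
    (one_sub_mul_eq_one_sub_mul_mul_one_sub hx).symm
  have hps : p * (p * x * (1 - p)) = p * x * (1 - p) := by simp only [← mul_assoc, hp.eq]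
  have hsq : p * x * (1 - p) * (1 - p) = p * x * (1 - p) := by rw [mul_assoc, hqq]
  have hpe : p * e = e := he.mul_eq_of_mul_eq hpxp
  have hep : e * p = e := he.mul_eq_of_mul_eq' hxp
  have hqw : (1 - p) * w = w := hw.mul_eq_of_mul_eq hqx
  have hwq : w * (1 - p) = w := hw.mul_eq_of_mul_eq' hqxq
  have hsplit : x = x * p + (1 - p) * x + p * x * (1 - p) := by rw [hx]; noncomm_ring
  have hxX : x * (e + w + S) =
      x * p * e + (1 - p) * x * w + (x * p * S + p * x * (1 - p) * w) := by
    conv_lhs => rw [hsplit]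
    exact triangular_mul_triangular hpq hqp hxp hqxq hsq hpe hqw hpS
  have hXx : (e + w + S) * x =
      e * (x * p) + w * ((1 - p) * x) + (e * (p * x * (1 - p)) + S * ((1 - p) * x)) := by
    conv_lhs => rw [hsplit]
    exact triangular_mul_triangular hpq hqp hep hwq hSp hpxp hqx hps
  refine ⟨?_, by rw [hxX, hXx, he.comm, hw.comm, hsyl], ?_⟩
  · rw [hXx, triangular_mul_triangular hpq hqp (by rw [mul_assoc, hxp])
      (by rw [mul_assoc, hqxq]) (by rw [add_mul, mul_assoc e, hsq, mul_assoc S, hqxq]) hpe hqw hpS,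
      he.mul_mul_self, hw.mul_mul_self]
    congr 1
    conv_rhs => rw [← hS, he.comm]
    rw [add_mul, mul_assoc S]
    abel
  · have hXp : (e + w + S) * p = e := by
      rw [add_mul, add_mul, hep, ← hwq, ← hSp, mul_assoc, mul_assoc, hqp]; simp
    have hqX : (1 - p) * (e + w + S) = w := by
      rw [mul_add, mul_add, hqw, ← hpe, ← hpS, ← mul_assoc, ← mul_assoc, hqp]; simp
    refine isQuasinilpotent_sub_sq_mul_of_triangular hp hx ?_ ?_ ?_
    · rw [mul_assoc p, hXp, hpe]
    · rw [hXp]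
      exact he.quasinilpotent
    · rw [hqX]
      exact hw.quasinilpotent

variable [CompleteSpace A]

theorem summable_spectralIdem_mul_pow (ha : GDInvertible a) (s y : A) (k : ℕ) :
    Summable fun n : ℕ => aᵖⁱ * a ^ n * s * y ^ (n + k) := by
  simpa only [spectralIdem, pow_add _ _ k, (Commute.pow_pow (Commute.refl y) _ k).eq, mul_assoc]
    using ha.isGDrazinInverse.summable_one_sub_mul_pow (s * y ^ k) y

theorem summable_pow_mul_spectralIdem (hc : GDInvertible c) (s y : A) (k : ℕ) :
    Summable fun n : ℕ => y ^ (n + k) * s * (c ^ n * cᵖⁱ) := by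
  simpa only [spectralIdem, pow_add _ _ k, mul_assoc]
    using hc.isGDrazinInverse.summable_pow_mul_one_sub (y ^ k * s) y

theorem mul_triangularCorner (ha : GDInvertible a) (hc : GDInvertible c) (h : Commute a z) :
    z * triangularCorner a s c = triangularCorner a (z * s) c := by
  have hd : Commute aᵈ z := ha.isGDrazinInverse.commute_of_commute h
  have hpi : Commute aᵖⁱ z := (Commute.one_left z).sub_left (h.mul_left hd)
  have hP (n : ℕ) : aᵖⁱ * a ^ n * (z * s) = z * (aᵖⁱ * a ^ n * s) := by
    rw [← mul_assoc, (hpi.mul_left (h.pow_left n)).eq, mul_assoc]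
  have hQ (n : ℕ) : aᵈ ^ n * (z * s) = z * (aᵈ ^ n * s) := by
    rw [← mul_assoc, (hd.pow_left n).eq, mul_assoc]
  simp only [triangularCorner, hP, hQ, mul_assoc z]
  rw [← mul_assoc aᵈ z, hd.eq]
  simp only [mul_assoc z, mul_sub, mul_add, (summable_spectralIdem_mul_pow ha s cᵈ 2).tsum_mul_left,
    (summable_pow_mul_spectralIdem hc s aᵈ 2).tsum_mul_left]

theorem triangularCorner_mul (ha : GDInvertible a) (hc : GDInvertible c) (h : Commute c z) :
    triangularCorner a s c * z = triangularCorner a (s * z) c := by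
  have hd : Commute cᵈ z := hc.isGDrazinInverse.commute_of_commute h
  have hpi : Commute cᵖⁱ z := (Commute.one_left z).sub_left (h.mul_left hd)
  rw [triangularCorner, triangularCorner, sub_mul, add_mul,
    ← (summable_spectralIdem_mul_pow ha s cᵈ 2).tsum_mul_right,
    ← (summable_pow_mul_spectralIdem hc s aᵈ 2).tsum_mul_right]
  simp only [mul_assoc, (hd.pow_left _).eq, ((h.pow_left _).mul_left hpi).eq, hd.eq]

theorem mul_triangularCorner_add (ha : GDInvertible a) (hc : GDInvertible c) :
    a * triangularCorner a s c + s * cᵈ = aᵈ * s + triangularCorner a s c * c := by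
  have hA := ha.isGDrazinInverse
  have hC := hc.isGDrazinInverse
  obtain ⟨P, hP⟩ : ∃ P, P = ∑' n : ℕ, aᵖⁱ * a ^ n * s * cᵈ ^ (n + 2) := ⟨_, rfl⟩
  obtain ⟨Q, hQ⟩ : ∃ Q, Q = ∑' n : ℕ, aᵈ ^ (n + 2) * s * (c ^ n * cᵖⁱ) := ⟨_, rfl⟩
  have hPc : P * c = aᵖⁱ * s * cᵈ + a * P := by
    have hcd (n : ℕ) : cᵈ ^ (n + 2) * c = cᵈ ^ (n + 1) := by
      rw [pow_succ, pow_succ, mul_assoc, mul_assoc, ← hC.comm, hC.mul_idem]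
    have haa (n : ℕ) : a * (aᵖⁱ * (a ^ n * (s * cᵈ ^ (n + 2)))) =
        aᵖⁱ * (a ^ (n + 1) * (s * cᵈ ^ (n + 2))) := by
      rw [pow_succ' a, ← mul_assoc a aᵖⁱ, ha.commute_spectralIdem.eq, mul_assoc, mul_assoc a]
    have hshift := (summable_spectralIdem_mul_pow ha s cᵈ 1).tsum_eq_zero_add
    have hsum := summable_spectralIdem_mul_pow ha s cᵈ 2
    rw [hP, ← hsum.tsum_mul_right, ← hsum.tsum_mul_left]
    simpa only [mul_assoc, hcd, haa, pow_zero, pow_one, one_mul, zero_add] using hshift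
  have haQ : a * Q = aᵈ * s * cᵖⁱ + Q * c := by
    have had (n : ℕ) : a * aᵈ ^ (n + 2) = aᵈ ^ (n + 1) := by
      rw [pow_succ', pow_succ', ← mul_assoc, ← mul_assoc, hA.idem_mul]
    have hcc (n : ℕ) : c ^ n * (cᵖⁱ * c) = c ^ (n + 1) * cᵖⁱ := by
      rw [pow_succ, mul_assoc, hc.commute_spectralIdem.eq]
    have hshift := (summable_pow_mul_spectralIdem hc s aᵈ 1).tsum_eq_zero_add
    have hsum := summable_pow_mul_spectralIdem hc s aᵈ 2
    rw [hQ, ← hsum.tsum_mul_right, ← hsum.tsum_mul_left]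
    simp only [← mul_assoc a, had]
    simpa only [mul_assoc, hcc, pow_zero, pow_one, one_mul, zero_add] using hshift
  rw [triangularCorner, ← hP, ← hQ, mul_sub, mul_add, sub_mul, add_mul, hPc, haQ]
  simp only [spectralIdem, mul_sub, sub_mul, mul_one, one_mul, mul_assoc, hC.comm]
  abel

theorem idem_mul_triangularCorner_add (ha : GDInvertible a) (hc : GDInvertible c) :
    a * aᵈ * triangularCorner a s c + triangularCorner a s c * (c * cᵈ) + aᵈ * s * cᵈ =
      triangularCorner a s c := by
  have hA := ha.isGDrazinInverse
  have hC := hc.isGDrazinInverse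
  obtain ⟨P, hP⟩ : ∃ P, P = ∑' n : ℕ, aᵖⁱ * a ^ n * s * cᵈ ^ (n + 2) := ⟨_, rfl⟩
  obtain ⟨Q, hQ⟩ : ∃ Q, Q = ∑' n : ℕ, aᵈ ^ (n + 2) * s * (c ^ n * cᵖⁱ) := ⟨_, rfl⟩
  have hsumP := summable_spectralIdem_mul_pow ha s cᵈ 2
  have hsumQ := summable_pow_mul_spectralIdem hc s aᵈ 2
  have haP : a * aᵈ * P = 0 := by
    have hpi : a * aᵈ * aᵖⁱ = 0 := hA.isIdempotentElem.mul_one_sub_self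
    simp only [hP, ← hsumP.tsum_mul_left, ← mul_assoc _ aᵖⁱ, ← mul_assoc (a * aᵈ), hpi, zero_mul,
      tsum_zero]
  have haQ : a * aᵈ * Q = Q := by
    rw [hQ, ← hsumQ.tsum_mul_left]
    simp only [← mul_assoc, pow_succ' aᵈ, hA.idem_mul]
  have hPc : P * (c * cᵈ) = P := by
    rw [hP, ← hsumP.tsum_mul_right]
    simp only [mul_assoc, pow_succ cᵈ, hC.mul_idem]
  have hQc : Q * (c * cᵈ) = 0 := by
    have hpi : cᵖⁱ * (c * cᵈ) = 0 := hC.isIdempotentElem.one_sub_mul_self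
    simp only [hQ, ← hsumQ.tsum_mul_right, mul_assoc _ cᵖⁱ, mul_assoc _ _ (c * cᵈ), hpi, mul_zero,
      tsum_zero]
  have hd : aᵈ * s * cᵈ * (c * cᵈ) = aᵈ * s * cᵈ := by rw [mul_assoc, hC.mul_idem]
  have hd' : a * aᵈ * (aᵈ * s * cᵈ) = aᵈ * s * cᵈ := by simp only [← mul_assoc, hA.idem_mul]
  rw [triangularCorner, ← hP, ← hQ, mul_sub, mul_add, sub_mul, add_mul, haP, haQ, hPc, hQc, hd, hd']
  abel

theorem isGDrazinInverse_of_triangular (hp : IsIdempotentElem p) (hx : x * p = p * x * p)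
    (he : GDInvertible (x * p)) (hw : GDInvertible ((1 - p) * x)) :
    IsGDrazinInverse x ((x * p)ᵈ + ((1 - p) * x)ᵈ +
      triangularCorner (x * p) (p * x * (1 - p)) ((1 - p) * x)) := by
  refine .of_triangular hp hx he.isGDrazinInverse hw.isGDrazinInverse ?_ ?_
    (mul_triangularCorner_add he hw) (idem_mul_triangularCorner_add he hw)
  · have hcomm : Commute (x * p) p := by
      rw [Commute, SemiconjBy, ← mul_assoc, ← hx, mul_assoc, hp.eq]
    rw [mul_triangularCorner he hw hcomm, ← mul_assoc, ← mul_assoc, hp.eq]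
  · have hcomm : Commute ((1 - p) * x) (1 - p) := by
      rw [Commute, SemiconjBy, ← one_sub_mul_eq_one_sub_mul_mul_one_sub hx, ← mul_assoc,
        hp.one_sub.eq]
    rw [triangularCorner_mul he hw hcomm, mul_assoc, hp.one_sub.eq]

theorem GDInvertible.iff_mul_right (hp : IsIdempotentElem p) (hx : x * p = p * x * p)
    (hw : GDInvertible ((1 - p) * x)) : GDInvertible x ↔ GDInvertible (x * p) :=
  ⟨fun h => h.mul_right hp hx hw, fun h => ⟨_, isGDrazinInverse_of_triangular hp hx h hw⟩⟩

theorem gdInv_eq_of_triangular (hp : IsIdempotentElem p) (hx : x * p = p * x * p)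
    (hxe : x * p = e) (hxw : (1 - p) * x = w) (he : GDInvertible e) (hw : GDInvertible w)
    (hs : p * x * (1 - p) = p * s * (1 - p)) :
    Summable (fun n : ℕ => eᵖⁱ * e ^ n * p * s * wᵈ ^ (n + 2)) ∧
    Summable (fun n : ℕ => eᵈ ^ (n + 2) * s * (1 - p) * x ^ n -
      eᵈ ^ (n + 2) * s * (1 - p) * x ^ (n + 1) * wᵈ) ∧
    xᵈ = eᵈ + wᵈ - eᵈ * s * wᵈ + (∑' n : ℕ, eᵖⁱ * e ^ n * p * s * wᵈ ^ (n + 2))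
      + ∑' n : ℕ, (eᵈ ^ (n + 2) * s * (1 - p) * x ^ n -
        eᵈ ^ (n + 2) * s * (1 - p) * x ^ (n + 1) * wᵈ) := by
  have hinv : xᵈ = eᵈ + wᵈ + triangularCorner e (p * x * (1 - p)) w := by
    subst hxe hxw
    exact (isGDrazinInverse_of_triangular hp hx he hw).eq_gdInv
  have hwq : w = w * (1 - p) := hxw ▸ one_sub_mul_eq_one_sub_mul_mul_one_sub hx
  have hqw : (1 - p) * w = w := by rw [← hxw, ← mul_assoc, hp.one_sub.eq]
  have hqwd : (1 - p) * wᵈ = wᵈ := hw.isGDrazinInverse.mul_eq_of_mul_eq hqw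
  have hedp : eᵈ * p = eᵈ :=
    he.isGDrazinInverse.mul_eq_of_mul_eq' (by rw [← hxe, mul_assoc, hp.eq])
  have hpow (n : ℕ) : (1 - p) * w ^ n = (1 - p) * x ^ n :=
    ((show Commute (1 - p) w from hqw.trans hwq).pow_right n).eq.trans
      ((show SemiconjBy (1 - p) x w from hxw.trans hwq).pow_right n).eq.symm
  have hleft (n : ℕ) : eᵖⁱ * e ^ n * (p * x * (1 - p)) * wᵈ ^ (n + 2) =
      eᵖⁱ * e ^ n * p * s * wᵈ ^ (n + 2) := by
    rw [hs, pow_succ' wᵈ]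
    simp only [mul_assoc]
    rw [← mul_assoc (1 - p), hqwd]
  have hright (n : ℕ) : eᵈ ^ (n + 2) * (p * x * (1 - p)) * (w ^ n * wᵖⁱ) =
      eᵈ ^ (n + 2) * s * (1 - p) * x ^ n - eᵈ ^ (n + 2) * s * (1 - p) * x ^ (n + 1) * wᵈ := by
    have hpi : (1 - p) * (w ^ n * wᵖⁱ) = (1 - p) * x ^ n - (1 - p) * x ^ (n + 1) * wᵈ := by
      rw [spectralIdem, mul_sub, mul_one, mul_sub, ← mul_assoc _ w, ← pow_succ, ← mul_assoc, hpow,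
        hpow]
    calc eᵈ ^ (n + 2) * (p * x * (1 - p)) * (w ^ n * wᵖⁱ)
        = eᵈ ^ (n + 1) * (eᵈ * p) * s * ((1 - p) * (w ^ n * wᵖⁱ)) := by
          rw [hs, pow_succ]
          simp only [mul_assoc]
      _ = eᵈ ^ (n + 2) * s * ((1 - p) * x ^ n - (1 - p) * x ^ (n + 1) * wᵈ) := by
          rw [hedp, ← pow_succ, hpi]
      _ = _ := by rw [mul_sub]; simp only [mul_assoc]
  have hmid : eᵈ * (p * x * (1 - p)) * wᵈ = eᵈ * s * wᵈ := by
    rw [hs, ← mul_assoc, ← mul_assoc, hedp, mul_assoc _ (1 - p), hqwd]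
  refine ⟨?_, ?_, ?_⟩
  · simpa only [hleft] using summable_spectralIdem_mul_pow he (p * x * (1 - p)) wᵈ 2
  · simpa only [hright] using summable_pow_mul_spectralIdem hw (p * x * (1 - p)) eᵈ 2
  · rw [hinv, triangularCorner]
    simp only [hleft, hright, hmid]
    abel

end Triangular

section Sum

variable {A : Type*} [NormedRing A] [NormedAlgebra ℂ A] {a b : A}

theorem mul_idem_eq_of_spectralIdem_mul (ha : GDInvertible a)
    (hab : aᵖⁱ * b * a = aᵖⁱ * a * b * aᵖⁱ) : b * (a * aᵈ) = a * aᵈ * b * (a * aᵈ) := by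
  have hpid : aᵖⁱ * aᵈ = 0 := by
    rw [spectralIdem, sub_mul, one_mul, ha.isGDrazinInverse.idem_mul, sub_self]
  have hzero : (1 - a * aᵈ) * b * (a * aᵈ) = 0 := by
    change aᵖⁱ * b * (a * aᵈ) = 0
    rw [← mul_assoc, hab, mul_assoc, hpid, mul_zero]
  rwa [sub_mul, sub_mul, one_mul, sub_eq_zero] at hzero

theorem isQuasinilpotent_mul_spectralIdem (ha : GDInvertible a) : IsQuasinilpotent (a * aᵖⁱ) := by
  convert ha.isGDrazinInverse.quasinilpotent using 1
  rw [spectralIdem]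
  noncomm_ring

theorem commute_spectralIdem_mul (ha : GDInvertible a)
    (hab : aᵖⁱ * b * a = aᵖⁱ * a * b * aᵖⁱ) : Commute (aᵖⁱ * b) (a * aᵖⁱ) := by
  have hq := ha.isIdempotentElem_spectralIdem
  have hqb : aᵖⁱ * b = aᵖⁱ * b * aᵖⁱ :=
    one_sub_mul_eq_one_sub_mul_mul_one_sub (mul_idem_eq_of_spectralIdem_mul ha hab)
  calc aᵖⁱ * b * (a * aᵖⁱ) = aᵖⁱ * a * b * (aᵖⁱ * aᵖⁱ) := by rw [← mul_assoc, hab, mul_assoc]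
    _ = a * (aᵖⁱ * b * aᵖⁱ) := by
      rw [hq.eq, ← ha.commute_spectralIdem.eq]
      simp only [mul_assoc]
    _ = a * aᵖⁱ * (aᵖⁱ * b) := by rw [← hqb, mul_assoc, ← mul_assoc aᵖⁱ aᵖⁱ, hq.eq]

variable [CompleteSpace A]

theorem neg_mul_spectralIdem_pow_mul_pow (ha : GDInvertible a) (hb : GDInvertible b)
    (hc : GDInvertible (aᵖⁱ * b)) (hqb : aᵖⁱ * b = aᵖⁱ * b * aᵖⁱ) (n : ℕ) :
    (-(a * aᵖⁱ)) ^ n * (aᵖⁱ * b)ᵈ ^ (n + 1) = aᵖⁱ * (-a) ^ n * bᵈ ^ (n + 1) := by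
  have hq := ha.isIdempotentElem_spectralIdem
  have haq : Commute (-a) aᵖⁱ := ha.commute_spectralIdem.neg_left
  have hqd : aᵖⁱ * (aᵖⁱ * b)ᵈ = (aᵖⁱ * b)ᵈ :=
    hc.isGDrazinInverse.mul_eq_of_mul_eq (by rw [← mul_assoc, hq.eq])
  have hdq : (aᵖⁱ * b)ᵈ * aᵖⁱ = (aᵖⁱ * b)ᵈ := hc.isGDrazinInverse.mul_eq_of_mul_eq' hqb.symm
  have hsemi : SemiconjBy aᵖⁱ bᵈ (aᵖⁱ * b)ᵈ :=
    (hc.isGDrazinInverse.mul_eq_mul_of_mul_eq_mul hb.isGDrazinInverse hqb.symm).symm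
  have hpow : (aᵖⁱ * b)ᵈ ^ (n + 1) = aᵖⁱ * bᵈ ^ (n + 1) := by
    rw [(hsemi.pow_right (n + 1)).eq, pow_succ, mul_assoc, hdq]
  have hpow' : aᵖⁱ * (aᵖⁱ * b)ᵈ ^ (n + 1) = (aᵖⁱ * b)ᵈ ^ (n + 1) := by
    rw [pow_succ', ← mul_assoc, hqd]
  calc (-(a * aᵖⁱ)) ^ n * (aᵖⁱ * b)ᵈ ^ (n + 1)
      = (-a) ^ n * (aᵖⁱ ^ n * aᵖⁱ) * (aᵖⁱ * b)ᵈ ^ (n + 1) := by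
        rw [← neg_mul, haq.mul_pow, mul_assoc, mul_assoc, mul_assoc, hpow']
    _ = aᵖⁱ * (-a) ^ n * bᵈ ^ (n + 1) := by
        rw [← pow_succ, hq.pow_succ_eq, mul_assoc, hpow', hpow, ← mul_assoc,
          (haq.pow_left n).eq]

theorem gdInvertible_and_hasSum_spectralIdem_mul_add (ha : GDInvertible a) (hb : GDInvertible b)
    (hab : aᵖⁱ * b * a = aᵖⁱ * a * b * aᵖⁱ) (hc : GDInvertible (aᵖⁱ * b)) :
    GDInvertible (aᵖⁱ * (a + b)) ∧
      HasSum (fun n : ℕ => aᵖⁱ * (-a) ^ n * bᵈ ^ (n + 1)) (aᵖⁱ * (a + b))ᵈ := by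
  have hqb : aᵖⁱ * b = aᵖⁱ * b * aᵖⁱ :=
    one_sub_mul_eq_one_sub_mul_mul_one_sub (mul_idem_eq_of_spectralIdem_mul ha hab)
  have hu := isQuasinilpotent_mul_spectralIdem ha
  have hterm := neg_mul_spectralIdem_pow_mul_pow ha hb hc hqb
  have hinv := hc.isGDrazinInverse.add_of_commute hu (commute_spectralIdem_mul ha hab)
  have hsum := hu.summable_neg_pow_mul_pow_succ (aᵖⁱ * b)ᵈ
  rw [ha.commute_spectralIdem.eq, add_comm, ← mul_add, ← ha.commute_spectralIdem.eq] at hinv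
  simp only [hterm] at hinv hsum
  exact ⟨⟨_, hinv⟩, hinv.eq_gdInv ▸ hsum.hasSum⟩

end Sum

theorem corollary2p7 {A : Type*} [NormedRing A] [NormedAlgebra ℂ A] [CompleteSpace A]
    (a b : A) (ha : GDInvertible a) (hb : GDInvertible b)
    (hab : aᵖⁱ * b * a = aᵖⁱ * a * b * aᵖⁱ)
    (hcorner : GDInvertible (aᵖⁱ * b * aᵖⁱ) ∨ GDInvertible (aᵖⁱ * b) ∨ GDInvertible (b * aᵖⁱ) ∨
      GDInvertible (a * aᵈ * b * a * aᵈ) ∨ GDInvertible (a * aᵈ * b) ∨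
      GDInvertible (b * a * aᵈ))
    (e : A) (he : e = (a + b) * a * aᵈ) :
    ((GDInvertible (a + b) ↔ GDInvertible (a * aᵈ * (a + b))) ∧
      (GDInvertible (a * aᵈ * (a + b)) ↔ GDInvertible e) ∧
      (GDInvertible e ↔ GDInvertible (a * aᵈ * (a + b) * a * aᵈ))) ∧
    (GDInvertible (a + b) →
      Summable (fun n : ℕ => aᵖⁱ * (-a) ^ n * bᵈ ^ (n + 1)) ∧
      Summable (fun n : ℕ => eᵈ * b * aᵖⁱ * (-a) ^ n * bᵈ ^ (n + 1)) ∧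
      Summable (fun n : ℕ => eᵖⁱ * e ^ n * a * aᵈ * b *
        (∑' k : ℕ, aᵖⁱ * (-a) ^ k * bᵈ ^ (k + 1)) ^ (n + 2)) ∧
      (∀ n : ℕ, Summable (fun k : ℕ =>
        eᵈ ^ (n + 2) * b * aᵖⁱ * (a + b) ^ (n + 1) * aᵖⁱ * (-a) ^ k * bᵈ ^ (k + 1))) ∧
      Summable (fun n : ℕ => eᵈ ^ (n + 2) * b * aᵖⁱ * (a + b) ^ n -
        ∑' k : ℕ,
          eᵈ ^ (n + 2) * b * aᵖⁱ * (a + b) ^ (n + 1) * aᵖⁱ * (-a) ^ k * bᵈ ^ (k + 1)) ∧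
      (a + b)ᵈ = eᵈ + (∑' n : ℕ, aᵖⁱ * (-a) ^ n * bᵈ ^ (n + 1))
        - (∑' n : ℕ, eᵈ * b * aᵖⁱ * (-a) ^ n * bᵈ ^ (n + 1))
        + (∑' n : ℕ, eᵖⁱ * e ^ n * a * aᵈ * b *
            (∑' k : ℕ, aᵖⁱ * (-a) ^ k * bᵈ ^ (k + 1)) ^ (n + 2))
        + ∑' n : ℕ, (eᵈ ^ (n + 2) * b * aᵖⁱ * (a + b) ^ n -
            ∑' k : ℕ,
              eᵈ ^ (n + 2) * b * aᵖⁱ * (a + b) ^ (n + 1) * aᵖⁱ * (-a) ^ k * bᵈ ^ (k + 1))) := by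
  have hp : IsIdempotentElem (a * aᵈ) := ha.isGDrazinInverse.isIdempotentElem
  have hap : Commute a (a * aᵈ) := ha.isGDrazinInverse.commute_idem
  have hbp := mul_idem_eq_of_spectralIdem_mul ha hab
  have hx : (a + b) * (a * aᵈ) = a * aᵈ * (a + b) * (a * aᵈ) := by
    rw [mul_add, add_mul, add_mul, ← hbp, ← hap.eq, mul_assoc, hp.eq]
  have hs : a * aᵈ * (a + b) * aᵖⁱ = a * aᵈ * b * aᵖⁱ := by
    rw [mul_add, add_mul, ← hap.eq, mul_assoc a, spectralIdem, hp.mul_one_sub_self, mul_zero,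
      zero_add]
  simp only [mul_assoc _ a aᵈ] at he hcorner ⊢
  obtain ⟨hw, hT⟩ := gdInvertible_and_hasSum_spectralIdem_mul_add ha hb hab
    (hb.one_sub_mul_of_corner hp hbp hcorner)
  have hiff : GDInvertible (a + b) ↔ GDInvertible e := he ▸ GDInvertible.iff_mul_right hp hx hw
  have hmul_comm : GDInvertible (a * aᵈ * (a + b)) ↔ GDInvertible e :=
    he ▸ ⟨GDInvertible.mul_comm, GDInvertible.mul_comm⟩
  rw [← hx, ← he]
  refine ⟨⟨hiff.trans hmul_comm.symm, hmul_comm, .rfl⟩, fun h => ?_⟩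
  obtain ⟨hleft, hright, hinv⟩ := gdInv_eq_of_triangular hp hx he.symm rfl (hiff.1 h) hw hs
  have hmulT (c : A) : HasSum (fun k : ℕ => c * aᵖⁱ * (-a) ^ k * bᵈ ^ (k + 1))
      (c * (aᵖⁱ * (a + b))ᵈ) := by
    simpa only [mul_assoc] using hT.mul_left c
  simp only [(hmulT _).tsum_eq, hT.tsum_eq]
  exact ⟨hT.summable, (hmulT _).summable, hleft, fun n => (hmulT _).summable, hright, hinv⟩
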